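/- Let $M\ge 2$ be an integer, $S=\{0,1,\dots,M\}$, and let $x_0,y_0\ge 1$ be integers with $x_0+y_0=M$. Let $P\colon S\times S\to[0,1]$ satisfy the border conditions $P(a,0)=1$ and $P(0,b)=0$ for all $a,b\in S\setminus\{0\}$ (the value $P(0,0)$ is irrelevant). Discrete two-person red-and-black game. The fortunes $X_n,Y_n\in S$ of players I and II start at $X_1=x_0$, $Y_1=y_0$. At each stage $n\ge 1$ the players simultaneously and independently choose integer bets $0\le a_n\le X_n$ and $0\le b_n\le Y_n$, where a bet of zero is allowed only to a player whose fortune is zero. Then $X_{n+1}=X_n+b_n$ with probability $P(a_n,b_n)$, $X_{n+1}=X_n-a_n$ with probability $1-P(a_n,b_n)$, and $Y_{n+1}=M-X_{n+1}$. (The states $X_n=0$ and $X_n=M$ are absorbing.) A strategy of a player assigns to every partial history $(X_1,\dots,X_n)$ an admissible bet or, more generally, a probability distribution on the admissible bets. Each player wants to maximize the probability that his own fortune ever reaches $M$; a pair of strategies is a Nash equilibrium if neither player can increase his probability of reaching $M$ by changing only his own strategy. A player plays boldly if he always bets his entire fortune, and timidly if he always bets one unit (as long as his fortune is positive). Assume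 that $$P(x,a)\,P(x+a,b)\le P(x,a+b)\qquad\text{for all } x\in\{0,\dots,M\},\ a\in\{0,\dots,M-x\},\ b\in\{0,\dots,M-a\},$$ and that the map $\varphi\colon S\to[0,1]$, $\varphi(x)=P(x,1)$, is nondecreasing and satisfies $$\varphi(y)-\varphi(x)\le\varphi(x-y)\,[\varphi(y)-1]\qquad\text{for all } x,y\in S \text{ with } y\le x.$$ Then the profile in which player I plays boldly and player II plays timidly is a Nash equilibrium of the game. -/

import Mathlib

open MeasureTheory ProbabilityTheory

namespace RedBlack

/-- The state space `S = {0, …, M}`; a state is the current fortune of player I. -/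
abbrev State (M : ℕ) : Type := Fin (M + 1)

/-- The fortune of player I in the state `x`. -/
def fortuneI {M : ℕ} (x : State M) : ℕ := x

/-- The fortune of player II in the state `x`; the total amount of money in the system is `M`. -/
def fortuneII {M : ℕ} (x : State M) : ℕ := M - x

/-- The bets available to a player whose fortune is `t`: integers between `0` and `t`,
where a bet of zero units is allowed only to a player with fortune zero. -/
abbrev Bet (t : ℕ) : Type := {a : ℕ // a ≤ t ∧ (0 < t → 0 < a)}

/-- The fortune of player I after he has lost a stage with the bet `a`. -/
def lose {M : ℕ} (x : State M) (a : Bet (fortuneI x)) : State M :=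
  ⟨x - a, by omega⟩

/-- The fortune of player I after he has won a stage against the bet `b` of player II. -/
def win {M : ℕ} (x : State M) (b : Bet (fortuneII x)) : State M :=
  ⟨x + b, by
    have h := b.2.1
    unfold fortuneII at h
    omega⟩

/-- The law of the next fortune of player I when the current one is `x` and the bets are `a`
and `b`: it is `x + b` with probability `P a b` and `x - a` with probability `1 - P a b`. -/
noncomputable def move {M : ℕ} (P : ℕ → ℕ → unitInterval) (x : State M)
    (a : Bet (fortuneI x)) (b : Bet (fortuneII x)) : PMF (State M) :=
  (bernoulliMeasure (win x b) (lose x a) (P a b)).toPMF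

/-- A partial history: the fortunes of player I at the times `0, …, n`. -/
abbrev History (M n : ℕ) : Type := (i : Finset.Iic n) → (fun _ : ℕ => State M) i

/-- The last state of a partial history. -/
def History.last {M n : ℕ} (h : History M n) : State M :=
  h ⟨n, Finset.mem_Iic.2 le_rfl⟩

/-- A (history-dependent, possibly randomized) strategy of a player whose fortune in the state
`x` is `f x`: it assigns to every partial history a probability distribution on the bets that are
available to him. -/
def Strategy (M : ℕ) (f : State M → ℕ) : Type :=
  (n : ℕ) → (h : History M n) → PMF (Bet (f h.last))

/-- The bold strategy: always bet the entire fortune. -/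
noncomputable def bold (M : ℕ) (f : State M → ℕ) : Strategy M f :=
  fun _ h => PMF.pure ⟨f h.last, le_rfl, id⟩

/-- The timid strategy: always bet one unit (zero units when the fortune is zero). -/
noncomputable def timid (M : ℕ) (f : State M → ℕ) : Strategy M f :=
  fun _ h => PMF.pure ⟨min 1 (f h.last), min_le_right _ _, fun ht => lt_min one_pos ht⟩

/-- The law of the next fortune of player I after the partial history `h`, when player I uses
`σ` and player II uses `τ`. The bets are chosen independently of each other. -/
noncomputable def stage {M : ℕ} (P : ℕ → ℕ → unitInterval) (σ : Strategy M fortuneI)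
    (τ : Strategy M fortuneII) (n : ℕ) (h : History M n) : PMF (State M) :=
  (σ n h).bind fun a => (τ n h).bind fun b => move P h.last a b

/-- The transition kernel of the game at time `n`. -/
noncomputable def stageKernel {M : ℕ} (P : ℕ → ℕ → unitInterval) (σ : Strategy M fortuneI)
    (τ : Strategy M fortuneII) (n : ℕ) : Kernel (History M n) (State M) :=
  Kernel.ofFunOfCountable fun h => (stage P σ τ n h).toMeasure

instance isMarkovKernel_stageKernel {M : ℕ} (P : ℕ → ℕ → unitInterval) (σ : Strategy M fortuneI)
    (τ : Strategy M fortuneII) (n : ℕ) : IsMarkovKernel (stageKernel P σ τ n) :=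
  ⟨fun h => PMF.toMeasure.isProbabilityMeasure (stage P σ τ n h)⟩

/-- The law of the whole sequence of fortunes of player I (the measure given by the
Ionescu-Tulcea theorem) when his initial fortune is `x₀`. -/
noncomputable def gameLaw {M : ℕ} (P : ℕ → ℕ → unitInterval) (x₀ : State M)
    (σ : Strategy M fortuneI) (τ : Strategy M fortuneII) : Measure (ℕ → State M) :=
  Kernel.traj (X := fun _ : ℕ => State M) (stageKernel P σ τ) 0 (fun _ => x₀)

/-- The probability that player I ever reaches his goal `M`. -/
noncomputable def winProbI {M : ℕ} (P : ℕ → ℕ → unitInterval) (x₀ : State M)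
    (σ : Strategy M fortuneI) (τ : Strategy M fortuneII) : ENNReal :=
  gameLaw P x₀ σ τ {ω | ∃ n, fortuneI (ω n) = M}

/-- The probability that player II ever reaches his goal `M`. -/
noncomputable def winProbII {M : ℕ} (P : ℕ → ℕ → unitInterval) (x₀ : State M)
    (σ : Strategy M fortuneI) (τ : Strategy M fortuneII) : ENNReal :=
  gameLaw P x₀ σ τ {ω | ∃ n, fortuneII (ω n) = M}

/-- `(σ, τ)` is a Nash equilibrium: no player can increase the probability of reaching his goal
by a unilateral change of his strategy. -/
def IsNashEquilibrium {M : ℕ} (P : ℕ → ℕ → unitInterval) (x₀ : State M)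
    (σ : Strategy M fortuneI) (τ : Strategy M fortuneII) : Prop :=
  (∀ σ' : Strategy M fortuneI, winProbI P x₀ σ' τ ≤ winProbI P x₀ σ τ) ∧
    (∀ τ' : Strategy M fortuneII, winProbII P x₀ σ τ' ≤ winProbII P x₀ σ τ)

/-- The border conditions on `S × S`; the value `P 0 0` is arbitrary. -/
def BorderConditions (M : ℕ) (P : ℕ → ℕ → unitInterval) : Prop :=
  (∀ a, 0 < a → a ≤ M → P a 0 = 1) ∧ (∀ b, 0 < b → b ≤ M → P 0 b = 0)

end RedBlack

/-! Write φ(k) = P(k,1) and Q(x) = ∏_{x ≤ k < M} φ(k). When bold play meets timid play, each stage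
either ruins player I or gains him one unit, so Q(x) is his chance of reaching M. Against a timid
opponent Q is superharmonic for every bet a: Q(x-a) ≤ φ(x-a) Q(x+1), and the condition on φ with y =
a says φ(a) + (1-φ(a)) φ(x-a) ≤ φ(x) (`boldTimidValue_superharmonic_timid`). Against a bold opponent
1 - Q is superharmonic for every bet b: since Q(0) = 0, this means Q(x) ≤ P(x,b) Q(x+b), and the
product condition merges b unit wins into one win of size b (`boldTimidValue_subharmonic_bold`).
Hence no deviation gives player I more than Q(x₀) or player II more than 1 - Q(x₀)
(`gameLaw_exists_eq_le`). The given profile attains both bounds because it is decided within M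
stages (`le_gameLaw_bold_timid`). -/

namespace RedBlack

open scoped ENNReal

/-! ### Super- and submartingale bounds for hitting probabilities -/

section Trajectories

variable {M : ℕ}

/-- The extension of a partial history by one more state. -/
def History.snoc {n : ℕ} (h : History M n) (y : State M) : History M (n + 1) :=
  fun i => if hi : i.1 ≤ n then h ⟨i, Finset.mem_Iic.2 hi⟩ else y

@[simp]
lemma History.last_snoc {n : ℕ} (h : History M n) (y : State M) : (h.snoc y).last = y := by
  simp [History.last, History.snoc]

lemma History.exists_snoc_eq_iff {n : ℕ} (h : History M n) (y z : State M) :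
    (∃ i, h.snoc y i = z) ↔ (∃ i, h i = z) ∨ y = z := by
  constructor
  · rintro ⟨i, hi⟩
    by_cases hin : i.1 ≤ n
    · exact Or.inl ⟨⟨i, Finset.mem_Iic.2 hin⟩, by simpa [History.snoc, hin] using hi⟩
    · exact Or.inr (by simpa [History.snoc, hin] using hi)
  · rintro (⟨i, hi⟩ | rfl)
    · have hin := Finset.mem_Iic.1 i.2
      exact ⟨⟨i, Finset.mem_Iic.2 (hin.trans n.le_succ)⟩, by simpa [History.snoc, hin] using hi⟩
    · exact ⟨_, h.last_snoc y⟩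

/-- Tower property: condition on the history up to time n. It drives both inductions below. -/
lemma lintegral_partialTraj_succ (κ : (n : ℕ) → Kernel (History M n) (State M))
    [∀ n, IsMarkovKernel (κ n)] (n : ℕ) (h₀ : History M 0) (F : History M (n + 1) → ℝ≥0∞) :
    ∫⁻ h, F h ∂(Kernel.partialTraj (X := fun _ => State M) κ 0 (n + 1) h₀) =
      ∫⁻ h : History M n, ∫⁻ y, F (h.snoc y) ∂(κ n h)
        ∂(Kernel.partialTraj (X := fun _ => State M) κ 0 n h₀) := by
  have hF : Measurable F := measurable_of_countable F
  rw [Kernel.partialTraj_succ_eq_comp (Nat.zero_le n), Kernel.lintegral_comp _ _ _ hF]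
  refine lintegral_congr fun h => ?_
  have hI : Measurable (IicProdIoc (X := fun _ => State M) n (n + 1)) := measurable_IicProdIoc
  have : IsMarkovKernel ((κ n).map (MeasurableEquiv.piSingleton (X := fun _ => State M) n)) :=
    Kernel.IsMarkovKernel.map _ (MeasurableEquiv.measurable _)
  rw [Kernel.partialTraj_succ_self]
  refine (Kernel.lintegral_map _ hI h hF).trans ?_
  refine (Kernel.lintegral_id_prod (hF.comp hI) _ h).trans ?_
  refine (Kernel.lintegral_map _ (MeasurableEquiv.measurable _) h
    (measurable_of_countable _)).trans ?_
  refine lintegral_congr fun y => congrArg F (funext fun i => ?_)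
  by_cases hi : i.1 ≤ n
  · simp [IicProdIoc, History.snoc, hi]
  · obtain ⟨i, hi'⟩ := i
    have : i = n + 1 := le_antisymm (Finset.mem_Iic.1 hi') (not_le.1 hi)
    subst this
    simp [IicProdIoc, History.snoc, MeasurableEquiv.piSingleton]

lemma lintegral_partialTraj_le (κ : (n : ℕ) → Kernel (History M n) (State M))
    [∀ n, IsMarkovKernel (κ n)] (h₀ : History M 0) (F : (n : ℕ) → History M n → ℝ≥0∞)
    (hF : ∀ n h, ∫⁻ y, F (n + 1) (h.snoc y) ∂(κ n h) ≤ F n h) (n : ℕ) :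
    ∫⁻ h, F n h ∂(Kernel.partialTraj (X := fun _ => State M) κ 0 n h₀) ≤ F 0 h₀ := by
  induction n with
  | zero =>
    rw [Kernel.partialTraj_self, Kernel.id_apply, lintegral_dirac' _ (measurable_of_countable _)]
  | succ n ih =>
    rw [lintegral_partialTraj_succ]
    exact (lintegral_mono fun h => hF n h).trans ih

lemma le_lintegral_partialTraj (κ : (n : ℕ) → Kernel (History M n) (State M))
    [∀ n, IsMarkovKernel (κ n)] (h₀ : History M 0) (F : (n : ℕ) → History M n → ℝ≥0∞)
    (hF : ∀ n h, F n h ≤ ∫⁻ y, F (n + 1) (h.snoc y) ∂(κ n h)) (n : ℕ) :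
    F 0 h₀ ≤ ∫⁻ h, F n h ∂(Kernel.partialTraj (X := fun _ => State M) κ 0 n h₀) := by
  induction n with
  | zero =>
    rw [Kernel.partialTraj_self, Kernel.id_apply, lintegral_dirac' _ (measurable_of_countable _)]
  | succ n ih =>
    rw [lintegral_partialTraj_succ]
    exact ih.trans (lintegral_mono fun h => hF n h)

lemma gameLaw_frestrictLe_preimage (P : ℕ → ℕ → unitInterval) (x₀ : State M)
    (σ : Strategy M fortuneI) (τ : Strategy M fortuneII) (n : ℕ) (s : Set (History M n)) :
    gameLaw P x₀ σ τ (Preorder.frestrictLe (π := fun _ => State M) n ⁻¹' s) =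
      Kernel.partialTraj (X := fun _ => State M) (stageKernel P σ τ) 0 n (fun _ => x₀) s := by
  rw [gameLaw, ← Measure.map_apply (Preorder.measurable_frestrictLe n) s.to_countable.measurableSet,
    Kernel.traj_map_frestrictLe_apply]

/-- A bounded superharmonic function which is `1` at a state dominates the probability of ever
visiting this state. -/
lemma gameLaw_exists_eq_le (P : ℕ → ℕ → unitInterval) (x₀ z : State M)
    (σ : Strategy M fortuneI) (τ : Strategy M fortuneII) (g : State M → ℝ≥0∞)
    (hg1 : ∀ x, g x ≤ 1) (hgz : g z = 1)
    (hg : ∀ n (h : History M n), ∫⁻ y, g y ∂(stage P σ τ n h).toMeasure ≤ g h.last) :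
    gameLaw P x₀ σ τ {ω | ∃ n, ω n = z} ≤ g x₀ := by
  classical
  let A (n : ℕ) : Set (History M n) := {h | ∃ i, h i = z}
  -- Freezing the value at 1 after the first visit to `z` makes the process a supermartingale
  -- without assuming that `z` is absorbing.
  let F (n : ℕ) (h : History M n) : ℝ≥0∞ := if h ∈ A n then 1 else g h.last
  have hF : ∀ n h, ∫⁻ y, F (n + 1) (h.snoc y) ∂(stageKernel P σ τ n h) ≤ F n h := by
    intro n h
    by_cases hh : h ∈ A n
    · calc ∫⁻ y, F (n + 1) (h.snoc y) ∂(stageKernel P σ τ n h)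
          ≤ ∫⁻ _, 1 ∂(stageKernel P σ τ n h) := lintegral_mono fun y => by
            dsimp only [F]; split_ifs
            exacts [le_rfl, hg1 _]
        _ = F n h := by simp [F, hh]
    · have key : ∀ y, F (n + 1) (h.snoc y) = g y := fun y => by
        by_cases hy : y = z
        · simp [F, hy, hgz]
        · have : h.snoc y ∉ A (n + 1) := fun H =>
            ((h.exists_snoc_eq_iff y z).1 H).elim hh hy
          simp [F, this]
      simp only [key]
      refine (hg n h).trans_eq ?_
      simp [F, hh]
  have hunion : {ω : ℕ → State M | ∃ n, ω n = z} =
      ⋃ n, Preorder.frestrictLe (π := fun _ => State M) n ⁻¹' A n := by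
    ext ω
    simp only [Set.mem_ofPred_eq, Set.mem_iUnion, Set.mem_preimage, A]
    exact ⟨fun ⟨n, hn⟩ => ⟨n, ⟨n, Finset.mem_Iic.2 le_rfl⟩, hn⟩, fun ⟨_, i, hi⟩ => ⟨i, hi⟩⟩
  have hmono : Monotone fun n => Preorder.frestrictLe (π := fun _ => State M) n ⁻¹' A n :=
    fun m n hmn ω ⟨i, hi⟩ => ⟨⟨i, Finset.mem_Iic.2 ((Finset.mem_Iic.1 i.2).trans hmn)⟩, hi⟩
  rw [hunion, hmono.measure_iUnion]
  refine iSup_le fun n => ?_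
  rw [gameLaw_frestrictLe_preimage, ← lintegral_indicator_one (A n).to_countable.measurableSet]
  calc _ ≤ _ := lintegral_mono fun h => Set.indicator_le (s := A n) (f := 1) (g := F n)
          (fun h hh => by simp [F, hh]) h
    _ ≤ F 0 fun _ => x₀ := lintegral_partialTraj_le _ _ F hF n
    _ ≤ g x₀ := by
      by_cases hx : x₀ = z
      · simp only [F, hx, hgz]
        split_ifs
        exacts [le_rfl, hgz.le]
      · simp [F, A, hx, History.last]

/-- A time-dependent subharmonic function which is eventually supported by a state is dominated
by the probability of ever visiting this state. -/
lemma le_gameLaw_exists_eq (P : ℕ → ℕ → unitInterval) (x₀ z : State M)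
    (σ : Strategy M fortuneI) (τ : Strategy M fortuneII) (f : ℕ → State M → ℝ≥0∞) (N : ℕ)
    (hfN : ∀ x, f N x ≤ if x = z then 1 else 0)
    (hf : ∀ n (h : History M n), f n h.last ≤ ∫⁻ y, f (n + 1) y ∂(stage P σ τ n h).toMeasure) :
    f 0 x₀ ≤ gameLaw P x₀ σ τ {ω | ∃ n, ω n = z} := by
  let A : Set (History M N) := {h | h.last = z}
  calc f 0 x₀
      ≤ ∫⁻ h : History M N, f N h.last ∂(Kernel.partialTraj (X := fun _ => State M)
          (stageKernel P σ τ) 0 N fun _ => x₀) := by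
        refine le_lintegral_partialTraj (stageKernel P σ τ) (fun _ => x₀)
          (fun n h => f n h.last) (fun n h => ?_) N
        simp only [History.last_snoc]
        exact hf n h
    _ ≤ ∫⁻ h, A.indicator 1 h ∂(Kernel.partialTraj (X := fun _ => State M)
          (stageKernel P σ τ) 0 N fun _ => x₀) := lintegral_mono fun h : History M N => by
        refine (hfN h.last).trans_eq ?_
        simp [A, Set.indicator_apply]
    _ = gameLaw P x₀ σ τ (Preorder.frestrictLe (π := fun _ => State M) N ⁻¹' A) := by
        rw [lintegral_indicator_one A.to_countable.measurableSet, gameLaw_frestrictLe_preimage]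
    _ ≤ gameLaw P x₀ σ τ {ω | ∃ n, ω n = z} := measure_mono fun ω (hω : ω N = z) => ⟨N, hω⟩

end Trajectories

/-! ### One stage of the game -/

section Stage

lemma lintegral_toMeasure_bind {α β : Type*} [MeasurableSpace β] [MeasurableSingletonClass β]
    [Countable β] (p : PMF α) (k : α → PMF β) (g : β → ℝ≥0∞) :
    ∫⁻ y, g y ∂(p.bind k).toMeasure = ∑' a, p a * ∫⁻ y, g y ∂(k a).toMeasure := by
  simp only [lintegral_countable', PMF.toMeasure_apply_singleton _ _ (measurableSet_singleton _),
    PMF.bind_apply, ← ENNReal.tsum_mul_left]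
  rw [ENNReal.tsum_comm]
  exact tsum_congr fun a => tsum_congr fun y => by ring

/-- A randomized bet averages deterministic ones, so it suffices to bound the latter. -/
lemma lintegral_toMeasure_bind_le {α β : Type*} [MeasurableSpace β] [MeasurableSingletonClass β]
    [Countable β] (p : PMF α) (k : α → PMF β) (g : β → ℝ≥0∞) (c : ℝ≥0∞)
    (h : ∀ a, ∫⁻ y, g y ∂(k a).toMeasure ≤ c) :
    ∫⁻ y, g y ∂(p.bind k).toMeasure ≤ c := by
  rw [lintegral_toMeasure_bind]
  calc ∑' a, p a * ∫⁻ y, g y ∂(k a).toMeasure ≤ ∑' a, p a * c := by gcongr; exact h _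
    _ = c := by rw [ENNReal.tsum_mul_right, p.tsum_coe, one_mul]

variable {M : ℕ} (P : ℕ → ℕ → unitInterval)

lemma lintegral_move (x : State M) (a : Bet (fortuneI x)) (b : Bet (fortuneII x)) (g : ℕ → ℝ)
    (hg : ∀ x ≤ M, 0 ≤ g x) :
    ∫⁻ y, ENNReal.ofReal (g y) ∂(move P x a b).toMeasure =
      ENNReal.ofReal (P a b * g (x + b) + (1 - P a b) * g (x - a)) := by
  have hw : 0 ≤ g (x + b) := hg _ (Nat.lt_succ_iff.1 (win x b).2)
  have hl : 0 ≤ g (x - a) := hg _ (Nat.lt_succ_iff.1 (lose x a).2)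
  have hp0 : (0 : ℝ) ≤ P a b := (P a b).2.1
  have hp1 : (0 : ℝ) ≤ 1 - P a b := sub_nonneg.2 (P a b).2.2
  rw [move, Measure.toPMF_toMeasure, bernoulliMeasure_def, lintegral_add_measure,
    lintegral_smul_measure, lintegral_smul_measure, lintegral_dirac, lintegral_dirac,
    ENNReal.ofReal_add (by positivity) (by positivity), ENNReal.ofReal_mul hp0,
    ENNReal.ofReal_mul hp1]
  rw [ENNReal.smul_def, ENNReal.smul_def, smul_eq_mul, smul_eq_mul]
  congr 2
  · rw [ENNReal.ofReal]
    congr 1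
    ext
    simp [hp0]
  · rw [ENNReal.ofReal]
    congr 1
    ext
    simp [hp1]

lemma stage_bold_left (τ : Strategy M fortuneII) (n : ℕ) (h : History M n) :
    stage P (bold M fortuneI) τ n h =
      (τ n h).bind fun b => move P h.last ⟨fortuneI h.last, le_rfl, id⟩ b := by
  simp only [stage, bold, PMF.pure_bind]

lemma stage_timid_right (σ : Strategy M fortuneI) (n : ℕ) (h : History M n) :
    stage P σ (timid M fortuneII) n h =
      (σ n h).bind fun a => move P h.last a
        ⟨min 1 (fortuneII h.last), min_le_right _ _, fun ht => lt_min one_pos ht⟩ := by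
  simp only [stage, timid, PMF.pure_bind]

lemma stage_bold_timid (n : ℕ) (h : History M n) :
    stage P (bold M fortuneI) (timid M fortuneII) n h =
      move P h.last ⟨fortuneI h.last, le_rfl, id⟩
        ⟨min 1 (fortuneII h.last), min_le_right _ _, fun ht => lt_min one_pos ht⟩ := by
  simp only [stage, bold, timid, PMF.pure_bind]

end Stage

/-! ### The value of bold against timid play -/

section Value

variable {M : ℕ} {P : ℕ → ℕ → unitInterval}

/-- The probability that player I reaches `M` from the fortune `x` when he plays boldly against
a timid opponent. -/
noncomputable def boldTimidValue (M : ℕ) (P : ℕ → ℕ → unitInterval) (x : ℕ) : ℝ :=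
  ∏ k ∈ Finset.Ico x M, (P k 1 : ℝ)

lemma boldTimidValue_nonneg (x : ℕ) : 0 ≤ boldTimidValue M P x :=
  Finset.prod_nonneg fun k _ => (P k 1).2.1

lemma boldTimidValue_le_one (x : ℕ) : boldTimidValue M P x ≤ 1 :=
  Finset.prod_le_one (fun k _ => (P k 1).2.1) fun k _ => (P k 1).2.2

@[simp]
lemma boldTimidValue_self : boldTimidValue M P M = 1 := by simp [boldTimidValue]

lemma boldTimidValue_of_lt {x : ℕ} (hx : x < M) :
    boldTimidValue M P x = P x 1 * boldTimidValue M P (x + 1) :=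
  Finset.prod_eq_prod_Ico_succ_bot hx _

lemma boldTimidValue_zero (hM : 0 < M) (hP : BorderConditions M P) :
    boldTimidValue M P 0 = 0 := by
  rw [boldTimidValue_of_lt hM, hP.2 1 one_pos hM]
  simp

/-- Induction on `b`: peel the factor `P (x + b) 1` off the product and absorb it into `P x b` by
the product condition. -/
lemma boldTimidValue_le_of_mult
    (hmult : ∀ x a b : ℕ, x ≤ M → a ≤ M - x → b ≤ M - a →
      (P x a : ℝ) * (P (x + a) b : ℝ) ≤ (P x (a + b) : ℝ))
    {x b : ℕ} (hb : 0 < b) (hxb : x + b ≤ M) :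
    boldTimidValue M P x ≤ P x b * boldTimidValue M P (x + b) := by
  induction b, hb using Nat.le_induction with
  | base => exact (boldTimidValue_of_lt (by omega)).le
  | succ b hb ih =>
    calc boldTimidValue M P x ≤ P x b * boldTimidValue M P (x + b) := ih (by omega)
      _ = P x b * P (x + b) 1 * boldTimidValue M P (x + b + 1) := by
        rw [boldTimidValue_of_lt (by omega : x + b < M), mul_assoc]
      _ ≤ P x (b + 1) * boldTimidValue M P (x + (b + 1)) :=
        mul_le_mul_of_nonneg_right (hmult x b 1 (by omega) (by omega) (by omega))
          (boldTimidValue_nonneg _)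

/-- To climb from `y` to M one must win at `y` and later climb from `x`; the factors strictly
between are at most 1. -/
lemma boldTimidValue_le_mul {x y : ℕ} (hyx : y < x) (hx : x < M) :
    boldTimidValue M P y ≤ P y 1 * (P x 1 * boldTimidValue M P (x + 1)) := by
  rw [boldTimidValue_of_lt (hyx.trans hx), ← boldTimidValue_of_lt hx]
  refine mul_le_mul_of_nonneg_left ?_ (P y 1).2.1
  rw [boldTimidValue, boldTimidValue,
    ← Finset.prod_Ico_consecutive _ (Nat.succ_le_of_lt hyx) hx.le]
  exact mul_le_of_le_one_left (boldTimidValue_nonneg x)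
    (Finset.prod_le_one (fun k _ => (P k 1).2.1) fun k _ => (P k 1).2.2)

/-- Against a timid opponent no bet of player I improves on the value of bold play. -/
lemma boldTimidValue_superharmonic_timid (hP : BorderConditions M P)
    (hphi : ∀ x y : ℕ, x ≤ M → y ≤ x →
      (P y 1 : ℝ) - (P x 1 : ℝ) ≤ (P (x - y) 1 : ℝ) * ((P y 1 : ℝ) - 1))
    {x a : ℕ} (hx : x ≤ M) (hM : 0 < M) (hax : a ≤ x) (ha : 0 < x → 0 < a) :
    P a (min 1 (M - x)) * boldTimidValue M P (x + min 1 (M - x)) +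
      (1 - P a (min 1 (M - x))) * boldTimidValue M P (x - a) ≤ boldTimidValue M P x := by
  rcases hx.eq_or_lt with rfl | hx
  -- At fortune M the opponent bets zero, and the border condition keeps the state fixed.
  · simp [hP.1 a (ha hM) hax]
  rw [min_eq_left (by omega : 1 ≤ M - x)]
  rcases x.eq_zero_or_pos with rfl | hx0
  · obtain rfl : a = 0 := by omega
    simp [hP.2 1 one_pos hM]
  have h1 := boldTimidValue_le_mul (P := P) (by have := ha hx0; omega : x - a < x) hx
  have h2 := hphi x a hx.le hax
  rw [boldTimidValue_of_lt hx]
  have hQ := boldTimidValue_nonneg (M := M) (P := P) (x + 1)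
  set Q := boldTimidValue M P (x + 1)
  have ha1 : (0 : ℝ) ≤ 1 - P a 1 := sub_nonneg.2 (P a 1).2.2
  have h3 : (P (x - a) 1 : ℝ) * (P x 1 * Q) ≤ P (x - a) 1 * Q :=
    mul_le_mul_of_nonneg_left (mul_le_of_le_one_left hQ (P x 1).2.2) (P (x - a) 1).2.1
  calc P a 1 * Q + (1 - P a 1) * boldTimidValue M P (x - a)
      ≤ P a 1 * Q + (1 - P a 1) * (P (x - a) 1 * Q) := by gcongr; exact h1.trans h3
    _ = (P a 1 + (1 - P a 1) * P (x - a) 1) * Q := by ring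
    _ ≤ P x 1 * Q := by gcongr; linarith

/-- Against a bold opponent no bet of player II improves on the value of timid play. -/
lemma boldTimidValue_subharmonic_bold (hP : BorderConditions M P)
    (hmult : ∀ x a b : ℕ, x ≤ M → a ≤ M - x → b ≤ M - a →
      (P x a : ℝ) * (P (x + a) b : ℝ) ≤ (P x (a + b) : ℝ))
    {x b : ℕ} (hx : x ≤ M) (hM : 0 < M) (hbx : b ≤ M - x) (hb : 0 < M - x → 0 < b) :
    P x b * (1 - boldTimidValue M P (x + b)) +
      (1 - P x b) * (1 - boldTimidValue M P (x - x)) ≤ 1 - boldTimidValue M P x := by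
  rw [Nat.sub_self, boldTimidValue_zero hM hP]
  suffices boldTimidValue M P x ≤ P x b * boldTimidValue M P (x + b) by linarith
  rcases hx.eq_or_lt with rfl | hx
  · obtain rfl : b = 0 := by omega
    simp [hP.1 x hM le_rfl]
  · exact boldTimidValue_le_of_mult hmult (hb (by omega)) (by omega)

/-- When bold play meets timid play, the game is decided after at most `M` stages, and a
function satisfying the recursion of the game is dominated by the probability of visiting the
state at which it lives. -/
lemma le_gameLaw_bold_timid (hM : 0 < M) (hP : BorderConditions M P) (x₀ z : State M) (g : ℕ → ℝ)
    (hg0 : ∀ x, 0 ≤ g x)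
    (hg : ∀ x < M, g x ≤ P x 1 * g (x + 1) + (1 - P x 1) * g 0)
    (hz : ∀ x : State M, x.1 = 0 ∨ x.1 = M → g x ≤ if x = z then 1 else 0) :
    ENNReal.ofReal (g x₀) ≤
      gameLaw P x₀ (bold M fortuneI) (timid M fortuneII) {ω | ∃ n, ω n = z} := by
  classical
  -- Under bold against timid play an undecided fortune at time n equals x₀ + n, so lower interior
  -- states are unreachable and may get the value 0. At time M no interior state survives the
  -- cutoff.
  let f (n x : ℕ) : ℝ := if x = 0 ∨ x = M ∨ x₀ + n ≤ x then g x else 0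
  have hf0 : ∀ n x, 0 ≤ f n x := fun n x => by
    dsimp only [f]; split_ifs
    exacts [hg0 x, le_rfl]
  have hstep : ∀ n x, x ≤ M → f n x ≤ P x (min 1 (M - x)) * f (n + 1) (x + min 1 (M - x)) +
      (1 - P x (min 1 (M - x))) * f (n + 1) (x - x) := by
    intro n x hx
    rcases hx.eq_or_lt with rfl | hx
    · simp [f, hP.1 x hM le_rfl]
    rw [min_eq_left (by omega : 1 ≤ M - x), Nat.sub_self]
    rcases x.eq_zero_or_pos with rfl | hx0
    · simp [f, hP.2 1 one_pos hM]
    by_cases hn : x₀ + n ≤ x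
    · have h1 : f (n + 1) (x + 1) = g (x + 1) := if_pos (Or.inr (Or.inr (by omega)))
      have h2 : f (n + 1) 0 = g 0 := if_pos (Or.inl rfl)
      have h3 : f n x = g x := if_pos (Or.inr (Or.inr hn))
      rw [h1, h2, h3]
      exact hg x hx
    · have h3 : f n x = 0 := if_neg (by omega)
      rw [h3]
      have := hf0 (n + 1) (x + 1)
      have := hf0 (n + 1) 0
      have : (0 : ℝ) ≤ P x 1 := (P x 1).2.1
      have : (0 : ℝ) ≤ 1 - P x 1 := sub_nonneg.2 (P x 1).2.2
      positivity
  have key := le_gameLaw_exists_eq P x₀ z (bold M fortuneI) (timid M fortuneII)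
    (fun n x => ENNReal.ofReal (f n x)) M (fun x => ?_) (fun n h => ?_)
  · simpa [f] using key
  · have hx := Nat.lt_succ_iff.1 x.2
    by_cases hx' : x.1 = 0 ∨ x.1 = M
    · have h1 : f M x = g x := if_pos (hx'.imp_right Or.inl)
      rw [h1]
      refine (ENNReal.ofReal_le_ofReal (hz x hx')).trans ?_
      split_ifs <;> simp
    · have h1 : f M x = 0 := if_neg (by omega)
      simp [h1]
  · rw [stage_bold_timid, lintegral_move P _ _ _ (f (n + 1)) fun x _ => hf0 _ x]
    exact ENNReal.ofReal_le_ofReal (hstep n _ (Nat.lt_succ_iff.1 h.last.2))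

lemma winProbI_eq (x₀ : State M) (σ : Strategy M fortuneI) (τ : Strategy M fortuneII) :
    winProbI P x₀ σ τ = gameLaw P x₀ σ τ {ω | ∃ n, ω n = Fin.last M} := by
  simp [winProbI, fortuneI, Fin.ext_iff]

lemma winProbII_eq (hM : 0 < M) (x₀ : State M) (σ : Strategy M fortuneI)
    (τ : Strategy M fortuneII) :
    winProbII P x₀ σ τ = gameLaw P x₀ σ τ {ω | ∃ n, ω n = 0} := by
  have (x : State M) : M - x.1 = M ↔ x = 0 := by
    rw [Fin.ext_iff, Fin.val_zero]
    omega
  simp only [winProbII, fortuneII, this]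

end Value

/-! ### The equilibrium -/

lemma isNashEquilibrium_bold_timid {M : ℕ} (hM : 0 < M) (P : ℕ → ℕ → unitInterval)
    (hP : BorderConditions M P)
    (hmult : ∀ x a b : ℕ, x ≤ M → a ≤ M - x → b ≤ M - a →
      (P x a : ℝ) * (P (x + a) b : ℝ) ≤ (P x (a + b) : ℝ))
    (hphi : ∀ x y : ℕ, x ≤ M → y ≤ x →
      (P y 1 : ℝ) - (P x 1 : ℝ) ≤ (P (x - y) 1 : ℝ) * ((P y 1 : ℝ) - 1))
    (x₀ : State M) :
    IsNashEquilibrium P x₀ (bold M fortuneI) (timid M fortuneII) := by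
  have hQ0 : ∀ x, 0 ≤ boldTimidValue M P x := boldTimidValue_nonneg
  have hQ1 : ∀ x, 0 ≤ 1 - boldTimidValue M P x := fun x => sub_nonneg.2 (boldTimidValue_le_one x)
  have hzero := boldTimidValue_zero hM hP
  refine ⟨fun σ' => ?_, fun τ' => ?_⟩
  · rw [winProbI_eq, winProbI_eq]
    refine (gameLaw_exists_eq_le P x₀ (Fin.last M) σ' _
      (fun x => ENNReal.ofReal (boldTimidValue M P x))
      (fun x => ENNReal.ofReal_le_one.2 (boldTimidValue_le_one _)) (by simp)
      fun n h => ?_).trans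
      (le_gameLaw_bold_timid hM hP x₀ _ (boldTimidValue M P) hQ0 (fun x hx => ?_) fun x hx => ?_)
    · rw [stage_timid_right]
      refine lintegral_toMeasure_bind_le _ _ _ _ fun a => ?_
      rw [lintegral_move P _ _ _ (boldTimidValue M P) fun x _ => hQ0 x]
      exact ENNReal.ofReal_le_ofReal (boldTimidValue_superharmonic_timid hP hphi
        (Nat.lt_succ_iff.1 h.last.2) hM a.2.1 a.2.2)
    · rw [hzero, boldTimidValue_of_lt hx]
      simp
    · rcases hx with hx | hx
      · rw [hx, hzero]
        split_ifs <;> simp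
      · rw [if_pos (Fin.ext hx)]
        exact boldTimidValue_le_one _
  · rw [winProbII_eq hM, winProbII_eq hM]
    -- Player II's goal is the state 0, where 1 - Q equals 1; the same two bounds apply to 1 - Q.
    refine (gameLaw_exists_eq_le P x₀ 0 _ τ'
      (fun x => ENNReal.ofReal (1 - boldTimidValue M P x))
      (fun x => ENNReal.ofReal_le_one.2 (sub_le_self _ (hQ0 _))) (by simp [hzero])
      fun n h => ?_).trans
      (le_gameLaw_bold_timid hM hP x₀ _ (fun x => 1 - boldTimidValue M P x) hQ1 (fun x hx => ?_)
        fun x hx => ?_)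
    · rw [stage_bold_left]
      refine lintegral_toMeasure_bind_le _ _ _ _ fun b => ?_
      rw [lintegral_move P _ _ _ (fun x => 1 - boldTimidValue M P x) fun x _ => hQ1 x]
      exact ENNReal.ofReal_le_ofReal (boldTimidValue_subharmonic_bold hP hmult
        (Nat.lt_succ_iff.1 h.last.2) hM b.2.1 b.2.2)
    · rw [hzero, boldTimidValue_of_lt hx]
      exact le_of_eq (by ring)
    · rcases hx with hx | hx
      · rw [if_pos (Fin.ext hx)]
        exact sub_le_self _ (hQ0 _)
      · rw [hx, boldTimidValue_self, sub_self]
        split_ifs <;> simp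

end RedBlack

theorem mainTheorem1 (M x₀ y₀ : ℕ) (hM : 2 ≤ M) (hx₀ : 0 < x₀) (hy₀ : 0 < y₀)
    (hxy : x₀ + y₀ = M)
    (P : ℕ → ℕ → unitInterval)
    (hP0 : RedBlack.BorderConditions M P)
    (hmult : ∀ x a b : ℕ, x ≤ M → a ≤ M - x → b ≤ M - a →
      (P x a : ℝ) * (P (x + a) b : ℝ) ≤ (P x (a + b) : ℝ))
    (hmono : ∀ x y : ℕ, x ≤ y → y ≤ M → P x 1 ≤ P y 1)
    (hphi : ∀ x y : ℕ, x ≤ M → y ≤ x →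
      (P y 1 : ℝ) - (P x 1 : ℝ) ≤ (P (x - y) 1 : ℝ) * ((P y 1 : ℝ) - 1)) :
    RedBlack.IsNashEquilibrium P (⟨x₀, by omega⟩ : RedBlack.State M)
      (RedBlack.bold M RedBlack.fortuneI) (RedBlack.timid M RedBlack.fortuneII) := by
  exact RedBlack.isNashEquilibrium_bold_timid (by omega) P hP0 hmult hphi _
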